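/- Let $K$ be a field of characteristic zero, $n\ge 0$, and $P_n=K[x_1,\dots,x_n]$. In the algebra $\mathrm{End}_K(P_n)$ of all $K$-linear maps $P_n\to P_n$ consider multiplication by $x_i$, the partial derivative $\partial_i$, the invertible map $H_i=\partial_i x_i$ (so $H_i^{-1}:x^\alpha\mapsto(\alpha_i+1)^{-1}x^\alpha$) and the integration $\int_i=x_iH_i^{-1}:x^\alpha\mapsto(\alpha_i+1)^{-1}x_ix^\alpha$, for $i=1,\dots,n$. Let - $\mathbb A_n\subseteq\mathrm{End}_K(P_n)$ be the subalgebra generated by all $x_i,\partial_i,H_i^{-1}$ (the Jacobian algebra); - $\mathbb I_n\subseteq\mathbb A_n$ be the subalgebra generated by all $x_i,\partial_i,\int_i$ (the algebra of polynomial integro-differential operators); - $\mathbb F_{n,0}\subseteq\mathbb I_n$ be the subalgebra generated by all $e_{kk}(i)=\int_i^k\partial_i^k-\int_i^{k+1}\partial_i^{k+1}$, $1\le i\le n$, $k\ge 0$. For an algebra $A$ let $\mathcal J(A)$ be the set of its two-sided ideals, including $0$ and $A$. A map $f:\mathcal J(A)\to\mathcal J(B)$ is said to respect the operations if $f(\mathfrak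 a+\mathfrak b)=f(\mathfrak a)+f(\mathfrak b)$, $f(\mathfrak a\mathfrak b)=f(\mathfrak a)f(\mathfrak b)$ and $f(\mathfrak a\cap\mathfrak b)=f(\mathfrak a)\cap f(\mathfrak b)$ for all $\mathfrak a,\mathfrak b\in\mathcal J(A)$. The algebras $A$ and $B$ are ideal equivalent if there is a bijection $\mathcal J(A)\to\mathcal J(B)$ that respects the operations. Let $\mathcal J(\mathbb F_{n,0})_{\sigma,\tau}$ be the set of all ideals $\mathfrak b$ of $\mathbb F_{n,0}$ such that $\sigma_i(\mathfrak b)\subseteq\mathfrak b$ and $\tau_i(\mathfrak b)\subseteq\mathfrak b$ for all $i$, where $\sigma_i(a)=\int_i a\,\partial_i$ and $\tau_i(a)=\partial_i a\int_i$. Then: 1. The restriction map $\mathcal J(\mathbb A_n)\to\mathcal J(\mathbb I_n)$, $\mathfrak a\mapsto\mathfrak a\cap\mathbb I_n$, is a bijection that respects the operations, and its inverse is the extension map $\mathfrak b\mapsto\mathbb A_n\mathfrak b\,\mathbb A_n$. In particular, $\mathbb I_n$ and $\mathbb A_n$ are ideal equivalent. 2. The algebra $\mathbb F_{n,0}$ is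 commutative. The restriction map $\mathfrak a\mapsto\mathfrak a\cap\mathbb F_{n,0}$ is a bijection from $\mathcal J(\mathbb I_n)$ onto $\mathcal J(\mathbb F_{n,0})_{\sigma,\tau}$ that respects the operations, and its inverse is $\mathfrak b\mapsto\mathbb I_n\mathfrak b\,\mathbb I_n$. 3. The restriction map $\mathfrak a\mapsto\mathfrak a\cap\mathbb F_{n,0}$ is a bijection from $\mathcal J(\mathbb A_n)$ onto $\mathcal J(\mathbb F_{n,0})_{\sigma,\tau}$ that respects the operations, and its inverse is $\mathfrak b\mapsto\mathbb A_n\mathfrak b\,\mathbb A_n$. -/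

import Mathlib

noncomputable section

namespace IntegroDiff

/-! ### Two-sided ideals and ideal equivalence -/

/-- The set of all two-sided ideals of a ring. For an algebra over a field these are the two-sided
ideals of the algebra, since a two-sided ideal is automatically a linear subspace. -/
abbrev TwoSided (R : Type*) [Ring R] : Type _ := {I : Ideal R // I.IsTwoSided}

section TwoSided

variable {R : Type*} [Ring R]

/-- The sum of two ideals. -/
instance : Add (TwoSided R) where
  add a b := ⟨a.1 + b.1, by
    refine ⟨fun {x} r hx => ?_⟩
    obtain ⟨u, hu, v, hv, rfl⟩ := Submodule.mem_sup.1 hx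
    rw [add_mul]
    exact Submodule.mem_sup.2
      ⟨u * r, a.2.mul_mem_of_left r hu, v * r, b.2.mul_mem_of_left r hv, rfl⟩⟩

/-- The product of two ideals: all finite sums of products `u * v` with `u ∈ a`, `v ∈ b`. -/
instance : Mul (TwoSided R) where
  mul a b := ⟨a.1 * b.1, by
    refine ⟨fun {x} r hx => ?_⟩
    induction hx using Submodule.smul_induction_on' with
    | smul u hu v hv =>
      rw [smul_eq_mul, mul_assoc]
      exact Ideal.mul_mem_mul hu (b.2.mul_mem_of_left r hv)
    | add u _ v _ hu hv => rw [add_mul]; exact Ideal.add_mem _ hu hv⟩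

/-- The intersection of two ideals. -/
instance : Min (TwoSided R) where
  min a b := ⟨a.1 ⊓ b.1,
    ⟨fun r hx => ⟨a.2.mul_mem_of_left r hx.1, b.2.mul_mem_of_left r hx.2⟩⟩⟩

end TwoSided

/-- `f` respects sums, products and intersections of ideals. -/
structure PreservesIdealOps {R S : Type*} [Ring R] [Ring S] (f : TwoSided R → TwoSided S) :
    Prop where
  map_add : ∀ a b : TwoSided R, f (a + b) = f a + f b
  map_mul : ∀ a b : TwoSided R, f (a * b) = f a * f b
  map_inf : ∀ a b : TwoSided R, f (a ⊓ b) = f a ⊓ f b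

/-- Two rings are ideal equivalent if there is a bijection between their sets of two-sided ideals
that respects sums, products and intersections. -/
def IdealEquivalent (R S : Type*) [Ring R] [Ring S] : Prop :=
  ∃ f : TwoSided R → TwoSided S, Function.Bijective f ∧ PreservesIdealOps f

/-! ### Restriction and extension of ideals along an inclusion of subalgebras -/

section ResExt

variable {K E : Type*} [Field K] [Ring E] [Algebra K E] {B A : Subalgebra K E}

/-- The restriction `a ↦ a ∩ B` of the ideals of `A` to a subalgebra `B ≤ A`. -/
def res (h : B ≤ A) (a : TwoSided A) : TwoSided B :=
  ⟨a.1.comap (Subalgebra.inclusion h), ⟨fun {x} r hx => by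
    have := a.2.mul_mem_of_left (Subalgebra.inclusion h r) hx
    simpa only [Ideal.mem_comap, map_mul] using this⟩⟩

/-- The extension `b ↦ A b A` of the ideals of a subalgebra `B ≤ A` to `A`: all finite sums of
products `a * u * c` with `u ∈ b` and `a, c ∈ A`. -/
def ext (h : B ≤ A) (b : TwoSided B) : TwoSided A :=
  ⟨Ideal.span {z : A | ∃ u ∈ b.1, ∃ c : A, z = Subalgebra.inclusion h u * c},
    ⟨fun {x} r hx => by
      induction hx using Submodule.span_induction with
      | mem z hz =>
        obtain ⟨u, hu, c, rfl⟩ := hz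
        exact Ideal.subset_span ⟨u, hu, c * r, mul_assoc _ _ _⟩
      | zero => rw [zero_mul]; exact Ideal.zero_mem _
      | add y z _ _ hy hz => rw [add_mul]; exact Ideal.add_mem _ hy hz
      | smul a y _ hy => rw [smul_eq_mul, mul_assoc]; exact Ideal.mul_mem_left _ a hy⟩⟩

end ResExt

/-! ### Operators on the polynomial algebra -/

section Operators

variable (K : Type*) [Field K] (n : ℕ)

/-- The algebra of all `K`-linear endomorphisms of `K[x_1, …, x_n]`. -/
abbrev EndP : Type _ := Module.End K (MvPolynomial (Fin n) K)

variable {n}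

/-- Multiplication by the variable `x_i`. -/
def X (i : Fin n) : EndP K n := LinearMap.mulLeft K (MvPolynomial.X i)

/-- The partial derivative `∂_i`. -/
def D (i : Fin n) : EndP K n := (MvPolynomial.pderiv i).toLinearMap

/-- The operator `H_i = ∂_i x_i`. -/
def H (i : Fin n) : EndP K n := D K i * X K i

/-- The operator `x^α ↦ (α_i + 1)⁻¹ x^α`; it is the inverse of `H_i` in characteristic zero. -/
def Hinv (i : Fin n) : EndP K n :=
  (MvPolynomial.basisMonomials (Fin n) K).constr K fun α =>
    MvPolynomial.monomial α ((α i + 1 : K)⁻¹)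

/-- The integration `∫_i : x^α ↦ (α_i + 1)⁻¹ x_i x^α`. -/
def J (i : Fin n) : EndP K n :=
  (MvPolynomial.basisMonomials (Fin n) K).constr K fun α =>
    MvPolynomial.monomial (α + Finsupp.single i 1) ((α i + 1 : K)⁻¹)

/-- The idempotent `e_kk(i) = ∫_i^k ∂_i^k - ∫_i^(k+1) ∂_i^(k+1)`. -/
def e (i : Fin n) (k : ℕ) : EndP K n := J K i ^ k * D K i ^ k - J K i ^ (k + 1) * D K i ^ (k + 1)

variable (n)

/-- The Jacobian algebra `A_n`, generated by the Weyl algebra (that is, by the `x_i` and `∂_i`) and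
the operators `H_i⁻¹`. -/
def jacobianAlgebra : Subalgebra K (EndP K n) :=
  Algebra.adjoin K (Set.range (X K) ∪ Set.range (D K) ∪ Set.range (Hinv K))

/-- The algebra `I_n` of polynomial integro-differential operators, generated by the `x_i`, `∂_i`
and `∫_i`. -/
def integroDiffAlgebra : Subalgebra K (EndP K n) :=
  Algebra.adjoin K (Set.range (X K) ∪ Set.range (D K) ∪ Set.range (J K))

/-- The algebra `F_{n,0} = ⨂_i F_{1,0}(i)`, where `F_{1,0}(i) = K ⊕ ⨁_k K e_kk(i)`: the subalgebra
generated by all the idempotents `e_kk(i)`. -/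
def diagonalAlgebra : Subalgebra K (EndP K n) :=
  Algebra.adjoin K {a | ∃ (i : Fin n) (k : ℕ), a = e K i k}

variable {n}

/-- `σ_i(a) = ∫_i a ∂_i`. -/
def sigma (i : Fin n) (a : EndP K n) : EndP K n := J K i * a * D K i

/-- `τ_i(a) = ∂_i a ∫_i`. -/
def tau (i : Fin n) (a : EndP K n) : EndP K n := D K i * a * J K i

variable (n)

/-- The ideals `b` of `F_{n,0}` with `σ_i(b) ⊆ b` and `τ_i(b) ⊆ b` for all `i`. -/
def stableIdeals : Set (TwoSided (diagonalAlgebra K n)) :=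
  {b | ∀ i : Fin n,
    (∀ a ∈ b.1, ∃ c ∈ b.1, (c : EndP K n) = sigma K i a) ∧
    (∀ a ∈ b.1, ∃ c ∈ b.1, (c : EndP K n) = tau K i a)}

variable {n}

/-! ### The inclusions `F_{n,0} ≤ I_n ≤ A_n` -/

theorem X_monomial (i : Fin n) (α : Fin n →₀ ℕ) (c : K) :
    X K i (MvPolynomial.monomial α c) = MvPolynomial.monomial (α + Finsupp.single i 1) c := by
  rw [X, LinearMap.mulLeft_apply, mul_comm, MvPolynomial.X, MvPolynomial.monomial_mul, mul_one]

theorem Hinv_monomial (i : Fin n) (α : Fin n →₀ ℕ) (c : K) :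
    Hinv K i (MvPolynomial.monomial α c) = MvPolynomial.monomial α (c * (α i + 1 : K)⁻¹) := by
  have h : (MvPolynomial.monomial α c : MvPolynomial (Fin n) K)
      = c • MvPolynomial.basisMonomials (Fin n) K α := by
    simp [MvPolynomial.smul_monomial]
  rw [h, map_smul, Hinv, Module.Basis.constr_basis, MvPolynomial.smul_monomial, smul_eq_mul]

theorem J_monomial (i : Fin n) (α : Fin n →₀ ℕ) (c : K) :
    J K i (MvPolynomial.monomial α c)
      = MvPolynomial.monomial (α + Finsupp.single i 1) (c * (α i + 1 : K)⁻¹) := by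
  have h : (MvPolynomial.monomial α c : MvPolynomial (Fin n) K)
      = c • MvPolynomial.basisMonomials (Fin n) K α := by
    simp [MvPolynomial.smul_monomial]
  rw [h, map_smul, J, Module.Basis.constr_basis, MvPolynomial.smul_monomial, smul_eq_mul]

theorem H_monomial (i : Fin n) (α : Fin n →₀ ℕ) (c : K) :
    H K i (MvPolynomial.monomial α c) = MvPolynomial.monomial α (c * (α i + 1 : K)) := by
  rw [H, Module.End.mul_apply, X_monomial]
  change MvPolynomial.pderiv i _ = _
  rw [MvPolynomial.pderiv_monomial, add_tsub_cancel_right]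
  simp

theorem H_mul_Hinv [CharZero K] (i : Fin n) : H K i * Hinv K i = 1 := by
  refine MvPolynomial.linearMap_ext fun α => LinearMap.ext fun c => ?_
  have h : (α i + 1 : K) ≠ 0 := Nat.cast_add_one_ne_zero _
  change H K i (Hinv K i (MvPolynomial.monomial α c)) = MvPolynomial.monomial α c
  rw [Hinv_monomial, H_monomial, inv_mul_cancel_right₀ h]

theorem Hinv_mul_H [CharZero K] (i : Fin n) : Hinv K i * H K i = 1 := by
  refine MvPolynomial.linearMap_ext fun α => LinearMap.ext fun c => ?_
  have h : (α i + 1 : K) ≠ 0 := Nat.cast_add_one_ne_zero _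
  change Hinv K i (H K i (MvPolynomial.monomial α c)) = MvPolynomial.monomial α c
  rw [H_monomial, Hinv_monomial, mul_inv_cancel_right₀ h]

theorem X_mul_Hinv (i : Fin n) : X K i * Hinv K i = J K i := by
  refine MvPolynomial.linearMap_ext fun α => LinearMap.ext fun c => ?_
  change X K i (Hinv K i (MvPolynomial.monomial α c)) = J K i (MvPolynomial.monomial α c)
  rw [Hinv_monomial, X_monomial, J_monomial]

variable (n)

theorem integroDiff_le_jacobian : integroDiffAlgebra K n ≤ jacobianAlgebra K n := by
  refine Algebra.adjoin_le ?_
  rintro _ ((⟨i, rfl⟩ | ⟨i, rfl⟩) | ⟨i, rfl⟩)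
  · exact Algebra.subset_adjoin (Or.inl (Or.inl ⟨i, rfl⟩))
  · exact Algebra.subset_adjoin (Or.inl (Or.inr ⟨i, rfl⟩))
  · rw [← X_mul_Hinv]
    exact mul_mem (Algebra.subset_adjoin (Or.inl (Or.inl ⟨i, rfl⟩)))
      (Algebra.subset_adjoin (Or.inr ⟨i, rfl⟩))

theorem diagonal_le_integroDiff : diagonalAlgebra K n ≤ integroDiffAlgebra K n := by
  refine Algebra.adjoin_le ?_
  rintro _ ⟨i, k, rfl⟩
  have hJ : J K i ∈ integroDiffAlgebra K n := Algebra.subset_adjoin (Or.inr ⟨i, rfl⟩)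
  have hD : D K i ∈ integroDiffAlgebra K n := Algebra.subset_adjoin (Or.inl (Or.inr ⟨i, rfl⟩))
  exact sub_mem (mul_mem (pow_mem hJ _) (pow_mem hD _)) (mul_mem (pow_mem hJ _) (pow_mem hD _))

theorem diagonal_le_jacobian : diagonalAlgebra K n ≤ jacobianAlgebra K n :=
  (diagonal_le_integroDiff K n).trans (integroDiff_le_jacobian K n)

end Operators

end IntegroDiff

end

noncomputable section

namespace IntegroDiff

/-! ### Diagonal operators: $\mathbb F_{n,0}$ as an algebra of functions of the exponent. -/

section Diagonal

variable {K : Type*} [Field K] {n : ℕ}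

/-! Let $A$ lie between $\mathbb I_n$ and $\mathbb A_n$. An ideal of $A$ is determined by its
diagonal part in $\mathbb F_{n,0}$ (`le_of_diagonal_le`). Indeed, elements of $\mathbb A_n$ are
finite sums of homogeneous operators $x^\alpha\mapsto f(\alpha)x^{\alpha+\gamma}$, with $f$ built
from the $(\alpha_i+c)^{\pm1}$. Commutators with the $H_i$ separate the degrees $\gamma$, and
$\int_i,\partial_i$ move each component reversibly to degree $0$. On every cell of a partition by
$\min(\alpha_i,N)$, a diagonal operator is a quotient of polynomials. Clearing the denominator and
taking differences inside the ideal leads to a nonzero constant, so the ideal contains the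
idempotent of each cell on which $f\ne0$ (`diag_cell_mem_of_degLT`).

Conversely, a stable ideal $\mathfrak b$ is recovered from its extension (`res_ext_of_stable`). The
algebra $\mathbb F_{n,0}$ is commutative and von Neumann regular, so elements of $\mathfrak b$ have
local units in $\mathfrak b$. Stability lets these units pass the generators of $\mathbb A_n$, so
each $z\in A\mathfrak bA$ satisfies $z=zw$ with $w\in\mathfrak b$.

Local units also make all ideals in question idempotent. Products are then intersections, which
restriction visibly respects. Comparing diagonal parts relates $\mathbb I_n$ to $\mathbb A_n$. -/

theorem end_ext {u v : EndP K n}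
    (h : ∀ α, u (MvPolynomial.monomial α 1) = v (MvPolynomial.monomial α 1)) : u = v :=
  (MvPolynomial.basisMonomials (Fin n) K).ext fun α => by
    simpa only [MvPolynomial.coe_basisMonomials] using h α

theorem D_monomial (i : Fin n) (α : Fin n →₀ ℕ) (c : K) :
    D K i (MvPolynomial.monomial α c)
      = MvPolynomial.monomial (α - Finsupp.single i 1) (c * α i) :=
  MvPolynomial.pderiv_monomial

/-- The diagonal operator `x^α ↦ f(α) x^α`, as a linear map from functions to operators. -/
def diagLinear : ((Fin n →₀ ℕ) → K) →ₗ[K] EndP K n :=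
  ((MvPolynomial.basisMonomials (Fin n) K).constr K).toLinearMap ∘ₗ
    LinearMap.pi fun α => MvPolynomial.monomial α ∘ₗ LinearMap.proj α

theorem diagLinear_monomial (f : (Fin n →₀ ℕ) → K) (α : Fin n →₀ ℕ) (c : K) :
    diagLinear f (MvPolynomial.monomial α c) = MvPolynomial.monomial α (f α * c) := by
  have e : (MvPolynomial.monomial α c : MvPolynomial (Fin n) K)
      = c • MvPolynomial.basisMonomials (Fin n) K α := by
    simp [MvPolynomial.smul_monomial]
  have h := (MvPolynomial.basisMonomials (Fin n) K).constr_basis K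
    (fun β => MvPolynomial.monomial β (f β)) α
  rw [e, map_smul]
  refine (congrArg _ h).trans ?_
  rw [MvPolynomial.smul_monomial, smul_eq_mul, mul_comm]

/-- The diagonal operator `x^α ↦ f(α) x^α`, as an algebra map from functions to operators. -/
def diag : ((Fin n →₀ ℕ) → K) →ₐ[K] EndP K n :=
  AlgHom.ofLinearMap diagLinear
    (end_ext fun α => by
      rw [diagLinear_monomial, Pi.one_apply, one_mul, Module.End.one_apply])
    (fun f g => end_ext fun α => by
      rw [Module.End.mul_apply, diagLinear_monomial, diagLinear_monomial, diagLinear_monomial,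
        Pi.mul_apply, mul_assoc])

theorem diag_monomial (f : (Fin n →₀ ℕ) → K) (α : Fin n →₀ ℕ) (c : K) :
    diag f (MvPolynomial.monomial α c) = MvPolynomial.monomial α (f α * c) :=
  diagLinear_monomial f α c

/-- The function `α ↦ f(α - e_i)`, extended by zero. -/
def shiftDown (i : Fin n) (f : (Fin n →₀ ℕ) → K) : (Fin n →₀ ℕ) → K :=
  fun α => if α i = 0 then 0 else f (α - Finsupp.single i 1)

/-- The function `α ↦ f(α + e_i)`. -/
def shiftUp (i : Fin n) (f : (Fin n →₀ ℕ) → K) : (Fin n →₀ ℕ) → K :=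
  fun α => f (α + Finsupp.single i 1)

theorem sub_single_add_single {α : Fin n →₀ ℕ} {i : Fin n} (h : α i ≠ 0) :
    α - Finsupp.single i 1 + Finsupp.single i 1 = α :=
  tsub_add_cancel_of_le (Finsupp.single_le_iff.2 (Nat.one_le_iff_ne_zero.2 h))

/-- The indicator function of `α_i = k`. -/
def ind (i : Fin n) (k : ℕ) : (Fin n →₀ ℕ) → K := fun α => if α i = k then 1 else 0

variable (K n) in
/-- The algebra of functions generated by the indicator functions of `α_i = k`. -/
def locConst : Subalgebra K ((Fin n →₀ ℕ) → K) :=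
  Algebra.adjoin K {f | ∃ (i : Fin n) (k : ℕ), f = ind i k}

theorem ind_mem_locConst (i : Fin n) (k : ℕ) : ind i k ∈ locConst K n :=
  Algebra.subset_adjoin ⟨i, k, rfl⟩

theorem finite_range_of_mem_locConst {f : (Fin n →₀ ℕ) → K} (hf : f ∈ locConst K n) :
    (Set.range f).Finite := by
  induction hf using Algebra.adjoin_induction with
  | mem f hf =>
    obtain ⟨i, k, rfl⟩ := hf
    refine (Set.toFinite {0, 1}).subset ?_
    rintro _ ⟨α, rfl⟩
    simp only [ind]
    split_ifs <;> simp
  | algebraMap r =>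
    refine (Set.finite_singleton r).subset ?_
    rintro _ ⟨α, rfl⟩
    rfl
  | add f g _ _ hf hg =>
    refine (hf.image2 (· + ·) hg).subset ?_
    rintro _ ⟨α, rfl⟩
    exact ⟨_, ⟨α, rfl⟩, _, ⟨α, rfl⟩, rfl⟩
  | mul f g _ _ hf hg =>
    refine (hf.image2 (· * ·) hg).subset ?_
    rintro _ ⟨α, rfl⟩
    exact ⟨_, ⟨α, rfl⟩, _, ⟨α, rfl⟩, rfl⟩

/-- The algebra `locConst` is von Neumann regular. -/
theorem exists_regular {f : (Fin n →₀ ℕ) → K} (hf : f ∈ locConst K n) :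
    ∃ g ∈ locConst K n, f * (g * f) = f := by
  classical
  set s := (finite_range_of_mem_locConst hf).toFinset with hs
  -- `f` has finitely many values; `P` interpolates inversion on them, so `P(f)` is the pointwise
  -- inverse. The convention `0⁻¹ = 0` is harmless, since `f` vanishes there.
  let P : Polynomial K := Lagrange.interpolate s id fun c => c⁻¹
  refine ⟨Polynomial.aeval f P,
    (Algebra.adjoin_le (Set.singleton_subset_iff.2 hf) :
      Algebra.adjoin K {f} ≤ locConst K n) (Polynomial.aeval_mem_adjoin_singleton K f), ?_⟩
  funext α
  have h1 : (Polynomial.aeval f P) α = Polynomial.eval (f α) P := by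
    have := Polynomial.aeval_algHom_apply (Pi.evalAlgHom K (fun _ : Fin n →₀ ℕ => K) α) f P
    exact this.symm
  have h2 : Polynomial.eval (f α) P = (f α)⁻¹ :=
    Lagrange.eval_interpolate_at_node (fun c : K => c⁻¹) (v := id) (Set.injOn_id _)
      (by simp [hs] : f α ∈ s)
  rw [Pi.mul_apply, Pi.mul_apply, h1, h2]
  by_cases h : f α = 0
  · simp [h]
  · rw [inv_mul_cancel₀ h, mul_one]

theorem shiftUp_mem (i : Fin n) {f : (Fin n →₀ ℕ) → K} (hf : f ∈ locConst K n) :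
    shiftUp i f ∈ locConst K n := by
  induction hf using Algebra.adjoin_induction with
  | mem f hf =>
    obtain ⟨j, k, rfl⟩ := hf
    by_cases hj : j = i
    · subst hj
      cases k with
      | zero =>
        convert zero_mem (locConst K n)
        funext α
        simp [shiftUp, ind]
      | succ k =>
        convert ind_mem_locConst (K := K) j k
        funext α
        simp [shiftUp, ind]
    · convert ind_mem_locConst (K := K) j k
      funext α
      simp [shiftUp, ind, hj]
  | algebraMap r => exact (locConst K n).algebraMap_mem r
  | add f g _ _ hf hg => exact add_mem hf hg
  | mul f g _ _ hf hg => exact mul_mem hf hg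

/-- Extension by zero makes `shiftDown` multiplicative but not unital. The factor `1 - ind i 0`
repairs this wherever the shifted function does not already vanish at `α i = 0`. -/
theorem shiftDown_mem (i : Fin n) {f : (Fin n →₀ ℕ) → K} (hf : f ∈ locConst K n) :
    shiftDown i f ∈ locConst K n := by
  induction hf using Algebra.adjoin_induction with
  | mem f hf =>
    obtain ⟨j, k, rfl⟩ := hf
    by_cases hj : j = i
    · subst hj
      convert ind_mem_locConst (K := K) j (k + 1)
      funext α
      simp only [shiftDown, ind, Finsupp.tsub_apply, Finsupp.single_eq_same]
      split_ifs <;> first | rfl | omega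
    · convert mul_mem (ind_mem_locConst (K := K) j k)
        (sub_mem (one_mem _) (ind_mem_locConst (K := K) i 0))
      funext α
      by_cases h : α i = 0 <;> simp [shiftDown, ind, hj, h]
  | algebraMap r =>
    convert (locConst K n).smul_mem (sub_mem (one_mem _) (ind_mem_locConst (K := K) i 0)) r
    funext α
    by_cases h : α i = 0 <;> simp [shiftDown, ind, h]
  | add f g _ _ hf hg =>
    convert add_mem hf hg
    funext α
    by_cases h : α i = 0 <;> simp [shiftDown, h]
  | mul f g _ _ hf hg =>
    convert mul_mem hf hg
    funext α
    by_cases h : α i = 0 <;> simp [shiftDown, h]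

/-- The indicator function of a fibre of `α ↦ (min(α_i, N))_i`. -/
def cell (N : ℕ) (k : Fin n → ℕ) : (Fin n →₀ ℕ) → K :=
  fun α => if (fun i => min (α i) N) = k then 1 else 0

theorem eventuallyConst_mem_locConst (i : Fin n) (N : ℕ) (g : ℕ → K) :
    (fun α : Fin n →₀ ℕ => g (min (α i) N)) ∈ locConst K n := by
  have : (fun α : Fin n →₀ ℕ => g (min (α i) N))
      = algebraMap K _ (g N) + ∑ j ∈ Finset.range N, (g j - g N) • ind i j := by
    funext α
    simp only [Pi.add_apply, Pi.algebraMap_apply, Algebra.algebraMap_self, RingHom.id_apply,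
      Finset.sum_apply, Pi.smul_apply, ind, smul_eq_mul, mul_ite, mul_one, mul_zero,
      Finset.sum_ite_eq, Finset.mem_range]
    split_ifs with h
    · rw [min_eq_left h.le]
      ring
    · rw [min_eq_right (not_lt.1 h), add_zero]
  rw [this]
  exact add_mem (Subalgebra.algebraMap_mem _ _)
    (sum_mem fun j _ => Subalgebra.smul_mem _ (ind_mem_locConst i j) _)

theorem cell_mem_locConst (N : ℕ) (k : Fin n → ℕ) : cell N k ∈ locConst K n := by
  have : (cell N k : (Fin n →₀ ℕ) → K)
      = ∏ i, fun α : Fin n →₀ ℕ => if min (α i) N = k i then 1 else 0 := by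
    funext α
    rw [Finset.prod_apply, Finset.prod_ite_zero]
    simp [cell, funext_iff]
  rw [this]
  exact prod_mem fun i _ => eventuallyConst_mem_locConst i N fun m => if m = k i then 1 else 0

theorem sum_cell (N : ℕ) :
    ∑ k ∈ Fintype.piFinset fun _ : Fin n => Finset.range (N + 1), cell N k
      = (1 : (Fin n →₀ ℕ) → K) := by
  funext α
  simp only [Finset.sum_apply, cell, Finset.sum_ite_eq, Fintype.mem_piFinset, Finset.mem_range,
    Pi.one_apply]
  rw [if_pos]
  intro i
  exact Nat.lt_succ_of_le (min_le_right _ _)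

section CharZero

variable [CharZero K]

/-- The factor $\alpha_i$ from $\partial_i$ cancels against the one from $\int_i$, leaving only the
shift; $\partial_i$ kills the monomials with $\alpha_i=0$. -/
theorem sigma_diag (i : Fin n) (f : (Fin n →₀ ℕ) → K) :
    sigma K i (diag f) = diag (shiftDown i f) := by
  refine end_ext fun α => ?_
  rw [sigma, Module.End.mul_apply, Module.End.mul_apply, D_monomial, diag_monomial, J_monomial,
    diag_monomial, shiftDown]
  split_ifs with h
  · simp [h]
  · have h1 : (((α - Finsupp.single i 1 : Fin n →₀ ℕ) i : ℕ) : K) + 1 = α i := by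
      rw [← Nat.cast_add_one]
      congr 1
      simp
      omega
    rw [sub_single_add_single h, h1, one_mul, mul_one,
      mul_inv_cancel_right₀ (Nat.cast_ne_zero.2 h)]

theorem tau_diag (i : Fin n) (f : (Fin n →₀ ℕ) → K) :
    tau K i (diag f) = diag (shiftUp i f) := by
  refine end_ext fun α => ?_
  have h : (α i + 1 : K) ≠ 0 := Nat.cast_add_one_ne_zero _
  rw [tau, Module.End.mul_apply, Module.End.mul_apply, J_monomial, diag_monomial, D_monomial,
    diag_monomial, shiftUp, add_tsub_cancel_right]
  simp [h]

theorem D_mul_J (i : Fin n) : D K i * J K i = 1 := by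
  have := tau_diag (K := K) i 1
  rwa [tau, map_one, mul_one, show shiftUp (K := K) i 1 = 1 from rfl, map_one] at this

theorem J_pow_mul_D_pow (i : Fin n) (k : ℕ) :
    J K i ^ k * D K i ^ k = diag fun α => if k ≤ α i then 1 else 0 := by
  induction k with
  | zero => exact (map_one (diag (K := K) (n := n))).symm
  | succ k ih =>
    rw [pow_succ', pow_succ (D K i), mul_assoc, ← mul_assoc (J K i ^ k), ih, ← mul_assoc]
    refine (sigma_diag i _).trans (congrArg _ (funext fun α => ?_))
    simp only [shiftDown, Finsupp.tsub_apply, Finsupp.single_eq_same]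
    split_ifs <;> first | rfl | omega

theorem e_eq_diag (i : Fin n) (k : ℕ) : e K i k = diag (ind i k) := by
  rw [e, J_pow_mul_D_pow, J_pow_mul_D_pow, ← map_sub]
  refine congrArg _ (funext fun α => ?_)
  simp only [Pi.sub_apply, ind]
  split_ifs <;> first | omega | simp

variable (K n) in
-- Reduces commutativity, regularity and stability under $\sigma_i,\tau_i$ to statements about
-- functions.
theorem diagonalAlgebra_eq : diagonalAlgebra K n = (locConst K n).map diag := by
  rw [diagonalAlgebra, locConst, AlgHom.map_adjoin]
  congr 1
  ext a
  simp only [Set.mem_ofPred_eq, Set.mem_image, e_eq_diag]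
  constructor
  · rintro ⟨i, k, rfl⟩
    exact ⟨_, ⟨i, k, rfl⟩, rfl⟩
  · rintro ⟨_, ⟨i, k, rfl⟩, rfl⟩
    exact ⟨i, k, rfl⟩

theorem mem_diagonalAlgebra {a : EndP K n} :
    a ∈ diagonalAlgebra K n ↔ ∃ f ∈ locConst K n, diag f = a := by
  rw [diagonalAlgebra_eq, Subalgebra.mem_map]

theorem mul_comm_of_mem_diagonalAlgebra {a b : EndP K n} (ha : a ∈ diagonalAlgebra K n)
    (hb : b ∈ diagonalAlgebra K n) : a * b = b * a := by
  obtain ⟨f, -, rfl⟩ := mem_diagonalAlgebra.1 ha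
  obtain ⟨g, -, rfl⟩ := mem_diagonalAlgebra.1 hb
  rw [← map_mul, mul_comm, map_mul]

theorem exists_mul_mul_eq_self {a : EndP K n} (ha : a ∈ diagonalAlgebra K n) :
    ∃ c ∈ diagonalAlgebra K n, a * (c * a) = a := by
  obtain ⟨f, hf, rfl⟩ := mem_diagonalAlgebra.1 ha
  obtain ⟨g, hg, h⟩ := exists_regular hf
  exact ⟨diag g, mem_diagonalAlgebra.2 ⟨g, hg, rfl⟩, by rw [← map_mul, ← map_mul, h]⟩

theorem sigma_mem (i : Fin n) {a : EndP K n} (ha : a ∈ diagonalAlgebra K n) :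
    sigma K i a ∈ diagonalAlgebra K n := by
  obtain ⟨f, hf, rfl⟩ := mem_diagonalAlgebra.1 ha
  exact mem_diagonalAlgebra.2 ⟨_, shiftDown_mem i hf, (sigma_diag i f).symm⟩

theorem tau_mem (i : Fin n) {a : EndP K n} (ha : a ∈ diagonalAlgebra K n) :
    tau K i a ∈ diagonalAlgebra K n := by
  obtain ⟨f, hf, rfl⟩ := mem_diagonalAlgebra.1 ha
  exact mem_diagonalAlgebra.2 ⟨_, shiftUp_mem i hf, (tau_diag i f).symm⟩

end CharZero

end Diagonal

/-! ### Polynomial functions, finite differences and cells. -/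

section Difference

variable {K : Type*} [Field K] {n : ℕ}

/-- The difference operator `f ↦ f(α + e_i) - f(α)`. -/
def diff (i : Fin n) (f : (Fin n →₀ ℕ) → K) : (Fin n →₀ ℕ) → K := shiftUp i f - f

/-- The functions annihilated by all `d`-fold iterated differences. -/
def DegLT : ℕ → ((Fin n →₀ ℕ) → K) → Prop
  | 0, f => f = 0
  | d + 1, f => ∀ i, DegLT d (diff i f)

theorem diff_zero (i : Fin n) : diff i (0 : (Fin n →₀ ℕ) → K) = 0 := by
  funext α
  simp [diff, shiftUp]

theorem degLT_zero : ∀ d, DegLT d (0 : (Fin n →₀ ℕ) → K)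
  | 0 => rfl
  | d + 1 => fun i => by
    rw [diff_zero]
    exact degLT_zero d

theorem DegLT.succ {d : ℕ} {f : (Fin n →₀ ℕ) → K} (h : DegLT d f) : DegLT (d + 1) f := by
  induction d generalizing f with
  | zero =>
    obtain rfl : f = 0 := h
    exact degLT_zero 1
  | succ d ih => exact fun i => ih (h i)

theorem DegLT.mono {d d' : ℕ} (hd : d ≤ d') {f : (Fin n →₀ ℕ) → K} (h : DegLT d f) :
    DegLT d' f := by
  induction hd with
  | refl => exact h
  | step _ ih => exact ih.succ

theorem DegLT.add {d : ℕ} {f g : (Fin n →₀ ℕ) → K} (hf : DegLT d f) (hg : DegLT d g) :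
    DegLT d (f + g) := by
  induction d generalizing f g with
  | zero =>
    obtain rfl : f = 0 := hf
    obtain rfl : g = 0 := hg
    exact add_zero 0
  | succ d ih =>
    intro i
    have : diff i (f + g) = diff i f + diff i g := by
      funext α
      simp only [diff, shiftUp, Pi.sub_apply, Pi.add_apply]
      ring
    rw [this]
    exact ih (hf i) (hg i)

theorem DegLT.mul {a b : ℕ} {f g : (Fin n →₀ ℕ) → K} (hf : DegLT a f) (hg : DegLT b g) :
    DegLT (a + b) (f * g) := by
  induction hs : a + b generalizing a b f g with
  | zero =>
    obtain rfl : a = 0 := by omega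
    obtain rfl : f = 0 := hf
    exact zero_mul g
  | succ s ih =>
    cases a with
    | zero =>
      obtain rfl : f = 0 := hf
      rw [zero_mul]
      exact degLT_zero _
    | succ a =>
      cases b with
      | zero =>
        obtain rfl : g = 0 := hg
        rw [mul_zero]
        exact degLT_zero _
      | succ b =>
        intro i
        -- The discrete Leibniz rule has an extra term; all three terms have bounds adding up to
        -- `s`. The bound is not sharp, but any finite one suffices.
        have : diff i (f * g) = diff i f * g + f * diff i g + diff i f * diff i g := by
          funext α
          simp only [diff, shiftUp, Pi.sub_apply, Pi.add_apply, Pi.mul_apply]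
          ring
        rw [this]
        refine ((ih (hf i) hg (by omega)).add (ih hf (hg i) (by omega))).add ?_
        exact ih (hf i).succ (hg i) (by omega)

variable (K n) in
/-- The algebra of polynomial functions of the exponent. -/
def polyFun : Subalgebra K ((Fin n →₀ ℕ) → K) :=
  Algebra.adjoin K (Set.range fun i α => (α i : K))

theorem coord_mem_polyFun (i : Fin n) : (fun α : Fin n →₀ ℕ => (α i : K)) ∈ polyFun K n :=
  Algebra.subset_adjoin ⟨i, rfl⟩

theorem exists_degLT {f : (Fin n →₀ ℕ) → K} (hf : f ∈ polyFun K n) : ∃ d, DegLT d f := by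
  have hc : ∀ r : K, DegLT 1 (algebraMap K ((Fin n →₀ ℕ) → K) r) := fun r i => by
    funext α
    simp [diff, shiftUp]
  induction hf using Algebra.adjoin_induction with
  | mem f hf =>
    obtain ⟨j, rfl⟩ := hf
    refine ⟨2, fun i => ?_⟩
    convert hc (Finsupp.single i (1 : K) j)
    funext α
    by_cases h : i = j <;> simp [diff, shiftUp, h]
  | algebraMap r => exact ⟨1, hc r⟩
  | add f g _ _ hf hg =>
    obtain ⟨a, hf⟩ := hf
    obtain ⟨b, hg⟩ := hg
    exact ⟨max a b, (hf.mono (le_max_left a b)).add (hg.mono (le_max_right a b))⟩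
  | mul f g _ _ hf hg =>
    obtain ⟨a, hf⟩ := hf
    obtain ⟨b, hg⟩ := hg
    exact ⟨a + b, hf.mul hg⟩

/-- The set on which `cell N k` equals `1`. -/
def cellSet (N : ℕ) (k : Fin n → ℕ) : Set (Fin n →₀ ℕ) := {α | ∀ i, min (α i) N = k i}

theorem cell_of_mem {N : ℕ} {k : Fin n → ℕ} {α : Fin n →₀ ℕ} (h : α ∈ cellSet N k) :
    cell (K := K) N k α = 1 := if_pos (funext h)

theorem cell_of_notMem {N : ℕ} {k : Fin n → ℕ} {α : Fin n →₀ ℕ} (h : α ∉ cellSet N k) :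
    cell (K := K) N k α = 0 := if_neg fun h' => h (congrFun h')

theorem add_single_mem_cellSet {N : ℕ} {k : Fin n → ℕ} {i : Fin n} (hi : k i = N)
    {α : Fin n →₀ ℕ} (h : α ∈ cellSet N k) : α + Finsupp.single i 1 ∈ cellSet N k := by
  intro j
  have hj := h j
  by_cases hij : i = j
  · subst hij
    simp only [Finsupp.add_apply, Finsupp.single_eq_same]
    omega
  · simpa [Finsupp.single_apply, hij] using hj

/-- A function on a cell whose differences in the unbounded directions vanish is constant. -/
theorem eq_of_diff_eq_zero {N : ℕ} {k : Fin n → ℕ} {f : (Fin n →₀ ℕ) → K}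
    (hf : ∀ i, k i = N → ∀ α ∈ cellSet N k, diff i f α = 0) {α : Fin n →₀ ℕ}
    (hα : α ∈ cellSet N k) : f α = f (Finsupp.equivFunOnFinite.symm k) := by
  induction hs : α.degree using Nat.strong_induction_on generalizing α with
  | _ s ih =>
    by_cases h : ∀ i, α i = k i
    · congr 1
      ext i
      exact h i
    · push Not at h
      obtain ⟨i, hi⟩ := h
      -- As `min (α i) N = k i` differs from `α i`, the direction `i` is unbounded and `α i > N`.
      -- One can thus step down inside the cell towards its corner `k`.
      have hm := hα i
      have h0 : α i ≠ 0 := by omega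
      have hk : k i = N := by omega
      have hmem : α - Finsupp.single i 1 ∈ cellSet N k := by
        intro j
        have hj := hα j
        by_cases hij : i = j
        · subst hij
          simp only [Finsupp.tsub_apply, Finsupp.single_eq_same]
          omega
        · simpa [Finsupp.single_apply, hij] using hj
      have hdeg : (α - Finsupp.single i 1).degree < s := by
        have := congrArg Finsupp.degree (sub_single_add_single h0)
        rw [map_add, Finsupp.degree_single] at this
        omega
      have hd := hf i hk _ hmem
      rw [diff, Pi.sub_apply, shiftUp, sub_single_add_single h0, sub_eq_zero] at hd
      rw [hd]
      exact ih _ hdeg hmem rfl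

theorem coord_add_mem_polyFun (i : Fin n) (c : ℤ) :
    (fun α : Fin n →₀ ℕ => (α i : K) + c) ∈ polyFun K n :=
  add_mem (coord_mem_polyFun i) (Subalgebra.algebraMap_mem _ (c : K))

theorem X_mem_integroDiff (i : Fin n) : X K i ∈ integroDiffAlgebra K n :=
  Algebra.subset_adjoin (Or.inl (Or.inl ⟨i, rfl⟩))

theorem D_mem_integroDiff (i : Fin n) : D K i ∈ integroDiffAlgebra K n :=
  Algebra.subset_adjoin (Or.inl (Or.inr ⟨i, rfl⟩))

theorem J_mem_integroDiff (i : Fin n) : J K i ∈ integroDiffAlgebra K n :=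
  Algebra.subset_adjoin (Or.inr ⟨i, rfl⟩)

theorem H_mem_integroDiff (i : Fin n) : H K i ∈ integroDiffAlgebra K n :=
  mul_mem (D_mem_integroDiff i) (X_mem_integroDiff i)

theorem diag_mem_integroDiff_of_polyFun {f : (Fin n →₀ ℕ) → K} (hf : f ∈ polyFun K n) :
    diag f ∈ integroDiffAlgebra K n := by
  suffices polyFun K n ≤ (integroDiffAlgebra K n).comap diag from this hf
  refine Algebra.adjoin_le ?_
  rintro _ ⟨i, rfl⟩
  have : diag (fun α : Fin n →₀ ℕ => (α i : K)) = H K i - 1 := by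
    refine end_ext fun α => ?_
    rw [diag_monomial, LinearMap.sub_apply, H_monomial, Module.End.one_apply, ← map_sub]
    congr 1
    ring
  refine Subalgebra.mem_comap _ _ _ |>.2 (this ▸ ?_)
  exact sub_mem (H_mem_integroDiff i) (one_mem _)

end Difference

/-! ### Diagonal elements of a bimodule and cell idempotents. -/

section Bimodule

variable {K : Type*} [Field K] [CharZero K] {n : ℕ}

/-- Stability of a subspace of operators under left and right multiplication by `A`. -/
def IsBimodule (A : Subalgebra K (EndP K n)) (M : Submodule K (EndP K n)) : Prop :=
  ∀ x ∈ A, ∀ u ∈ M, x * u ∈ M ∧ u * x ∈ M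

theorem diag_mem_integroDiff_of_locConst {f : (Fin n →₀ ℕ) → K} (hf : f ∈ locConst K n) :
    diag f ∈ integroDiffAlgebra K n :=
  diagonal_le_integroDiff K n (mem_diagonalAlgebra.2 ⟨f, hf, rfl⟩)

/-- A bimodule containing a polynomial multiple of a cell idempotent, not vanishing on that cell,
contains the cell idempotent. -/
theorem diag_cell_mem_of_degLT {M : Submodule K (EndP K n)}
    (hM : IsBimodule (integroDiffAlgebra K n) M) {N : ℕ} {k : Fin n → ℕ} {d : ℕ}
    {f : (Fin n →₀ ℕ) → K} (hd : DegLT d f) (hf : diag (f * cell N k) ∈ M)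
    (h0 : ∃ α ∈ cellSet N k, f α ≠ 0) : diag (cell N k) ∈ M := by
  induction d generalizing f with
  | zero =>
    obtain ⟨α, -, hα⟩ := h0
    exact absurd (congrFun (hd : f = 0) α) hα
  | succ d ih =>
    -- Either a difference in an unbounded direction survives on the cell and the degree bound
    -- drops, or `f` is constant there.
    by_cases h : ∃ i, k i = N ∧ ∃ α ∈ cellSet N k, diff i f α ≠ 0
    · obtain ⟨i, hi, hα⟩ := h
      refine ih (hd i) ?_ hα
      -- `tau` shifts the function and the cell idempotent cuts it back. The cell is stable under
      -- adding `e_i`, so subtracting the original leaves the difference of `f` on the cell.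
      have h1 : tau K i (diag (f * cell N k)) * diag (cell N k) ∈ M :=
        (hM _ (diag_mem_integroDiff_of_locConst (cell_mem_locConst N k)) _
          (hM _ (J_mem_integroDiff i) _ (hM _ (D_mem_integroDiff i) _ hf).1).2).2
      rw [tau_diag, ← map_mul] at h1
      have h2 : diff i f * cell N k
          = shiftUp i (f * cell N k) * cell N k - f * cell N k := by
        funext α
        by_cases hα : α ∈ cellSet N k
        · simp [diff, shiftUp, cell_of_mem hα, cell_of_mem (add_single_mem_cellSet hi hα)]
        · simp [cell_of_notMem hα]
      rw [h2, map_sub]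
      exact sub_mem h1 hf
    · push Not at h
      have hc := fun (α : Fin n →₀ ℕ) (hα : α ∈ cellSet N k) => eq_of_diff_eq_zero (f := f) h hα
      set c := f (Finsupp.equivFunOnFinite.symm k)
      obtain ⟨α, hα, hα0⟩ := h0
      rw [hc α hα] at hα0
      have h1 : cell N k = c⁻¹ • (f * cell N k) := by
        funext β
        by_cases hβ : β ∈ cellSet N k
        · simp [cell_of_mem hβ, hc β hβ, hα0]
        · simp [cell_of_notMem hβ]
      rw [h1, map_smul]
      exact M.smul_mem _ hf

variable (K n) in
/-- The algebra of functions generated by the functions `(α_i + c)^{±1}` with `c` an integer. -/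
def ratFun : Subalgebra K ((Fin n →₀ ℕ) → K) :=
  Algebra.adjoin K {f | ∃ (i : Fin n) (c : ℤ),
    f = (fun α => (α i : K) + c) ∨ f = fun α => ((α i : K) + c)⁻¹}

/-- On each cell of a fine enough partition a function in `ratFun` is a quotient of polynomials. -/
theorem eventually_quotient {f : (Fin n →₀ ℕ) → K} (hf : f ∈ ratFun K n) :
    ∀ᶠ N in Filter.atTop, ∀ k : Fin n → ℕ, ∃ q ∈ polyFun K n, ∃ p ∈ polyFun K n,
      ∀ α ∈ cellSet N k, q α ≠ 0 ∧ f α * q α = p α := by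
  induction hf using Algebra.adjoin_induction with
  | mem f hf =>
    obtain ⟨i, c, rfl | rfl⟩ := hf
    · exact Filter.Eventually.of_forall fun N k => ⟨1, one_mem _, _, coord_add_mem_polyFun i c,
        fun α _ => ⟨one_ne_zero, mul_one _⟩⟩
    -- For `N > |c|` the denominator cannot vanish on a cell unbounded in direction `i`. On the
    -- other cells `α i = k i` is fixed, so the function is a constant, possibly the default `0⁻¹ =
    -- 0`.
    · filter_upwards [Filter.eventually_gt_atTop c.natAbs] with N hN k
      by_cases hk : k i = N
      · refine ⟨_, coord_add_mem_polyFun i c, 1, one_mem _, fun α hα => ?_⟩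
        have hαi := hα i
        have h : (α i : K) + c ≠ 0 := by
          have : (α i : ℤ) + c ≠ 0 := by omega
          exact_mod_cast this
        exact ⟨h, inv_mul_cancel₀ h⟩
      · refine ⟨1, one_mem _, algebraMap K _ ((k i : K) + c)⁻¹, Subalgebra.algebraMap_mem _ _,
          fun α hα => ⟨one_ne_zero, ?_⟩⟩
        have hαi := hα i
        have : α i = k i := by omega
        simp [this]
  | algebraMap r =>
    exact Filter.Eventually.of_forall fun N k => ⟨1, one_mem _, _,
      (polyFun K n).algebraMap_mem r, fun α _ => ⟨one_ne_zero, mul_one _⟩⟩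
  | add f g _ _ hf hg =>
    filter_upwards [hf, hg] with N hf hg k
    obtain ⟨q, hq, p, hp, h⟩ := hf k
    obtain ⟨q', hq', p', hp', h'⟩ := hg k
    refine ⟨q * q', mul_mem hq hq', p * q' + q * p',
      add_mem (mul_mem hp hq') (mul_mem hq hp'), fun α hα => ?_⟩
    obtain ⟨h1, h2⟩ := h α hα
    obtain ⟨h1', h2'⟩ := h' α hα
    refine ⟨mul_ne_zero h1 h1', ?_⟩
    simp only [Pi.mul_apply, Pi.add_apply, ← h2, ← h2']
    ring
  | mul f g _ _ hf hg =>
    filter_upwards [hf, hg] with N hf hg k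
    obtain ⟨q, hq, p, hp, h⟩ := hf k
    obtain ⟨q', hq', p', hp', h'⟩ := hg k
    refine ⟨q * q', mul_mem hq hq', p * p', mul_mem hp hp', fun α hα => ?_⟩
    obtain ⟨h1, h2⟩ := h α hα
    obtain ⟨h1', h2'⟩ := h' α hα
    refine ⟨mul_ne_zero h1 h1', ?_⟩
    simp only [Pi.mul_apply, ← h2, ← h2']
    ring

/-- A diagonal operator with rational coefficients in a bimodule is generated by diagonal
idempotents of the bimodule. -/
theorem diag_mem_of_diagonal_le {A : Subalgebra K (EndP K n)} {M M' : Submodule K (EndP K n)}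
    (hA : integroDiffAlgebra K n ≤ A) (hMA : ∀ u ∈ M, u ∈ A) (hM : IsBimodule A M)
    (hM' : IsBimodule A M') (hle : ∀ u ∈ M, u ∈ diagonalAlgebra K n → u ∈ M')
    {f : (Fin n →₀ ℕ) → K} (hf : f ∈ ratFun K n) (hfM : diag f ∈ M) : diag f ∈ M' := by
  have hMI : IsBimodule (integroDiffAlgebra K n) M := fun x hx => hM x (hA hx)
  obtain ⟨N, hN⟩ := (eventually_quotient hf).exists
  -- The cell idempotents sum to `1`, so each cell can be treated separately.
  rw [← mul_one f, ← sum_cell N, Finset.mul_sum, map_sum]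
  refine sum_mem fun k _ => ?_
  by_cases h0 : ∃ α ∈ cellSet N k, f α ≠ 0
  · obtain ⟨q, hq, p, hp, h⟩ := hN k
    obtain ⟨d, hd⟩ := exists_degLT hp
    have hcell := cell_mem_locConst (K := K) N k
    -- Multiplying by the denominator `q`, which is itself available in $\mathbb I_n$, leaves a
    -- polynomial on the cell.
    have hpM : diag (p * cell N k) ∈ M := by
      have : p * cell N k = q * (f * cell N k) := by
        funext α
        by_cases hα : α ∈ cellSet N k
        · simp [cell_of_mem hα, ← (h α hα).2, mul_comm]
        · simp [cell_of_notMem hα]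
      rw [this, map_mul, map_mul]
      exact (hMI _ (diag_mem_integroDiff_of_polyFun hq) _
        (hMI _ (diag_mem_integroDiff_of_locConst hcell) _ hfM).2).1
    have hc : diag (cell N k) ∈ M := by
      refine diag_cell_mem_of_degLT hMI hd hpM ?_
      obtain ⟨α, hα, hα0⟩ := h0
      exact ⟨α, hα, (h α hα).2 ▸ mul_ne_zero hα0 (h α hα).1⟩
    rw [map_mul]
    exact (hM' _ (hMA _ hfM) _ (hle _ hc (mem_diagonalAlgebra.2 ⟨_, hcell, rfl⟩))).1
  · push Not at h0
    have : f * cell N k = 0 := by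
      funext α
      by_cases hα : α ∈ cellSet N k
      · simp [h0 α hα]
      · simp [cell_of_notMem hα]
    rw [this, map_zero]
    exact zero_mem _

end Bimodule

/-! ### The grading by multidegree. -/

section Grading

variable {K : Type*} [Field K] {n : ℕ}

/-- The homogeneous operators of degree `γ` with coefficients in `ratFun`. -/
def homog (γ : Fin n → ℤ) : Submodule K (EndP K n) where
  -- Where `α + γ` has a negative entry there is no target monomial, and the coefficient itself must
  -- vanish.
  carrier := {u | ∃ f ∈ ratFun K n, ∀ α : Fin n →₀ ℕ,
    (f α = 0 ∧ u (MvPolynomial.monomial α 1) = 0) ∨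
    ∃ β : Fin n →₀ ℕ, (∀ i, (β i : ℤ) = α i + γ i) ∧
      u (MvPolynomial.monomial α 1) = MvPolynomial.monomial β (f α)}
  zero_mem' := ⟨0, zero_mem _, fun _ => Or.inl ⟨rfl, rfl⟩⟩
  smul_mem' := by
    rintro c u ⟨f, hf, h⟩
    refine ⟨c • f, Subalgebra.smul_mem _ hf c, fun α => ?_⟩
    obtain ⟨h1, h2⟩ | ⟨β, hβ, h2⟩ := h α
    · exact Or.inl ⟨by simp [h1], by rw [LinearMap.smul_apply, h2, smul_zero]⟩
    · exact Or.inr ⟨β, hβ, by rw [LinearMap.smul_apply, h2, MvPolynomial.smul_monomial]; rfl⟩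
  add_mem' := by
    rintro u v ⟨f, hf, h⟩ ⟨g, hg, h'⟩
    refine ⟨f + g, add_mem hf hg, fun α => ?_⟩
    obtain ⟨h1, h2⟩ | ⟨β, hβ, h2⟩ := h α <;> obtain ⟨h1', h2'⟩ | ⟨β', hβ', h2'⟩ := h' α
    · exact Or.inl ⟨by simp [h1, h1'], by rw [LinearMap.add_apply, h2, h2', add_zero]⟩
    · exact Or.inr ⟨β', hβ', by simp [h2, h2', h1]⟩
    · exact Or.inr ⟨β, hβ, by simp [h2, h2', h1']⟩
    · obtain rfl : β = β' := Finsupp.ext fun i => by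
        have := (hβ i).trans (hβ' i).symm
        exact_mod_cast this
      exact Or.inr ⟨β, hβ, by rw [LinearMap.add_apply, h2, h2', ← map_add]; rfl⟩

theorem coord_add_mem_ratFun (i : Fin n) (c : ℤ) :
    (fun α : Fin n →₀ ℕ => (α i : K) + c) ∈ ratFun K n :=
  Algebra.subset_adjoin ⟨i, c, Or.inl rfl⟩

theorem coord_add_inv_mem_ratFun (i : Fin n) (c : ℤ) :
    (fun α : Fin n →₀ ℕ => ((α i : K) + c)⁻¹) ∈ ratFun K n :=
  Algebra.subset_adjoin ⟨i, c, Or.inr rfl⟩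

theorem one_mem_homog : (1 : EndP K n) ∈ homog 0 :=
  ⟨1, one_mem _, fun α => Or.inr ⟨α, by simp, rfl⟩⟩

theorem natCast_eq_of_intCast_eq {a b : ℕ} {c : ℤ} (h : (b : ℤ) = a + c) : (b : K) = a + c := by
  exact_mod_cast congrArg (Int.cast (R := K)) h

theorem X_mul_mem_homog (i : Fin n) {γ : Fin n → ℤ} {u : EndP K n} (hu : u ∈ homog γ) :
    X K i * u ∈ homog (γ + Pi.single i 1) := by
  obtain ⟨f, hf, h⟩ := hu
  refine ⟨f, hf, fun α => ?_⟩
  obtain ⟨h1, h2⟩ | ⟨β, hβ, h2⟩ := h α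
  · exact Or.inl ⟨h1, by rw [Module.End.mul_apply, h2, map_zero]⟩
  · refine Or.inr ⟨β + Finsupp.single i 1, fun j => ?_, ?_⟩
    · have := hβ j
      by_cases hij : j = i
      · subst hij
        simp only [Finsupp.add_apply, Finsupp.single_eq_same, Pi.add_apply, Pi.single_eq_same]
        push_cast
        omega
      · simpa [hij, Finsupp.single_apply, Ne.symm hij] using this
    · rw [Module.End.mul_apply, h2, X_monomial]

/-- After `u` the exponent is `α i + γ i`, so the new factor is `(α i + γ i + 1)⁻¹`; hence the
integer shifts in `ratFun`. -/
theorem Hinv_mul_mem_homog (i : Fin n) {γ : Fin n → ℤ} {u : EndP K n} (hu : u ∈ homog γ) :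
    Hinv K i * u ∈ homog γ := by
  obtain ⟨f, hf, h⟩ := hu
  refine ⟨_, mul_mem hf (coord_add_inv_mem_ratFun i (γ i + 1)), fun α => ?_⟩
  obtain ⟨h1, h2⟩ | ⟨β, hβ, h2⟩ := h α
  · exact Or.inl ⟨by simp [h1], by rw [Module.End.mul_apply, h2, map_zero]⟩
  · refine Or.inr ⟨β, hβ, ?_⟩
    rw [Module.End.mul_apply, h2, Hinv_monomial, natCast_eq_of_intCast_eq (K := K) (hβ i),
      Pi.mul_apply, Int.cast_add, Int.cast_one, add_assoc]

theorem J_mul_mem_homog (i : Fin n) {γ : Fin n → ℤ} {u : EndP K n} (hu : u ∈ homog γ) :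
    J K i * u ∈ homog (γ + Pi.single i 1) := by
  rw [← X_mul_Hinv, mul_assoc]
  exact X_mul_mem_homog i (Hinv_mul_mem_homog i hu)

theorem D_mul_mem_homog (i : Fin n) {γ : Fin n → ℤ} {u : EndP K n} (hu : u ∈ homog γ) :
    D K i * u ∈ homog (γ - Pi.single i 1) := by
  obtain ⟨f, hf, h⟩ := hu
  refine ⟨_, mul_mem hf (coord_add_mem_ratFun i (γ i)), fun α => ?_⟩
  obtain ⟨h1, h2⟩ | ⟨β, hβ, h2⟩ := h α
  · exact Or.inl ⟨by simp [h1], by rw [Module.End.mul_apply, h2, map_zero]⟩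
  · have hD : (D K i * u) (MvPolynomial.monomial α 1)
        = MvPolynomial.monomial (β - Finsupp.single i 1) (f α * (α i + γ i : K)) := by
      rw [Module.End.mul_apply, h2, D_monomial, natCast_eq_of_intCast_eq (K := K) (hβ i)]
    -- Here subtraction of exponents would truncate, but the factor `α i + γ i = β i` vanishes.
    by_cases h0 : β i = 0
    · have h3 : f α * (α i + γ i : K) = 0 := by
        rw [← natCast_eq_of_intCast_eq (K := K) (hβ i), h0, Nat.cast_zero, mul_zero]
      exact Or.inl ⟨h3, by rw [hD, h3, map_zero]⟩
    · refine Or.inr ⟨β - Finsupp.single i 1, fun j => ?_, hD⟩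
      have := hβ j
      by_cases hij : j = i
      · subst hij
        simp only [Finsupp.tsub_apply, Finsupp.single_eq_same, Pi.sub_apply, Pi.single_eq_same]
        omega
      · simpa [hij, Finsupp.single_apply, Ne.symm hij] using this

/-- The algebra is spanned by words in the generators, and each word is homogeneous. -/
theorem jacobianAlgebra_le_iSup_homog :
    Subalgebra.toSubmodule (jacobianAlgebra K n) ≤ ⨆ γ, homog γ := by
  rw [jacobianAlgebra, Algebra.adjoin_eq_span, Submodule.span_le]
  intro u hu
  suffices ∃ γ, u ∈ homog γ by
    obtain ⟨γ, h⟩ := this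
    exact Submodule.mem_iSup_of_mem γ h
  induction hu using Submonoid.closure_induction_left with
  | one => exact ⟨0, one_mem_homog⟩
  | mul_left x hx y _ ih =>
    obtain ⟨γ, h⟩ := ih
    obtain ((⟨i, rfl⟩ | ⟨i, rfl⟩) | ⟨i, rfl⟩) := hx
    · exact ⟨_, X_mul_mem_homog i h⟩
    · exact ⟨_, D_mul_mem_homog i h⟩
    · exact ⟨_, Hinv_mul_mem_homog i h⟩

theorem H_commutator (i : Fin n) {γ : Fin n → ℤ} {u : EndP K n} (hu : u ∈ homog γ) :
    H K i * u - u * H K i = (γ i : K) • u := by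
  obtain ⟨f, -, h⟩ := hu
  refine end_ext fun α => ?_
  have e : H K i (MvPolynomial.monomial α 1)
      = (α i + 1 : K) • MvPolynomial.monomial α 1 := by
    rw [H_monomial, MvPolynomial.smul_monomial, smul_eq_mul, mul_comm]
  rw [LinearMap.sub_apply, Module.End.mul_apply, Module.End.mul_apply, e, map_smul,
    LinearMap.smul_apply]
  obtain ⟨-, h2⟩ | ⟨β, hβ, h2⟩ := h α
  · simp [h2]
  · rw [h2, H_monomial, natCast_eq_of_intCast_eq (K := K) (hβ i), MvPolynomial.smul_monomial,
      MvPolynomial.smul_monomial, ← map_sub, smul_eq_mul, smul_eq_mul]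
    congr 1
    ring

theorem eq_diag_of_mem_homog_zero {u : EndP K n} (hu : u ∈ homog 0) :
    ∃ f ∈ ratFun K n, u = diag f := by
  obtain ⟨f, hf, h⟩ := hu
  refine ⟨f, hf, end_ext fun α => ?_⟩
  rw [diag_monomial, mul_one]
  obtain ⟨h1, h2⟩ | ⟨β, hβ, h2⟩ := h α
  · rw [h1, h2, map_zero]
  · obtain rfl : β = α := Finsupp.ext fun i => by simpa using hβ i
    exact h2

/-- $\int_i\partial_i$ is the projection onto the monomials divisible by $x_i$, and these contain
the image of an operator of positive degree in direction `i`. -/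
theorem J_mul_D_mul_eq_self [CharZero K] {i : Fin n} {γ : Fin n → ℤ} (hγ : 0 < γ i)
    {u : EndP K n} (hu : u ∈ homog γ) : J K i * (D K i * u) = u := by
  obtain ⟨f, -, h⟩ := hu
  refine end_ext fun α => ?_
  rw [Module.End.mul_apply, Module.End.mul_apply]
  obtain ⟨-, h2⟩ | ⟨β, hβ, h2⟩ := h α
  · rw [h2, map_zero, map_zero]
  · have hi := hβ i
    have h0 : β i ≠ 0 := by omega
    have h1 : (((β - Finsupp.single i 1 : Fin n →₀ ℕ) i : ℕ) : K) + 1 = β i := by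
      rw [← Nat.cast_add_one]
      congr 1
      simp
      omega
    rw [h2, D_monomial, J_monomial, sub_single_add_single h0, h1,
      mul_inv_cancel_right₀ (Nat.cast_ne_zero.2 h0)]

end Grading

/-! ### Bimodules are determined by their diagonal part. -/

section Main

variable {K : Type*} [Field K] [CharZero K] {n : ℕ}

/-- Bimodules of operators are homogeneous. -/
theorem homogeneous_of_isBimodule {A : Subalgebra K (EndP K n)} {M : Submodule K (EndP K n)}
    (hA : integroDiffAlgebra K n ≤ A) (hM : IsBimodule A M) (s : Finset (Fin n → ℤ))
    (u : (Fin n → ℤ) → EndP K n) (hu : ∀ γ, u γ ∈ homog γ) (hs : ∑ γ ∈ s, u γ ∈ M) :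
    ∀ γ ∈ s, u γ ∈ M := by
  classical
  induction s using Finset.induction_on generalizing u with
  | empty => simp
  | insert δ s hδ ih =>
    have key : ∀ γ ∈ s, u γ ∈ M := by
      intro γ hγ
      obtain ⟨i, hi⟩ : ∃ i, γ i ≠ δ i := by
        by_contra! h
        exact hδ (funext h ▸ hγ)
      have hH := hA (H_mem_integroDiff (K := K) i)
      -- The commutator with `H K i` minus `δ i` times the sum kills the `δ` component and scales
      -- the others. The chosen `γ` gets a nonzero factor, as the characteristic is zero.
      have h1 : ∑ γ ∈ s, ((γ i : K) - δ i) • u γ ∈ M := by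
        have h2 : ∑ γ ∈ s, ((γ i : K) - δ i) • u γ
            = H K i * (∑ γ ∈ insert δ s, u γ) - (∑ γ ∈ insert δ s, u γ) * H K i
              - (δ i : K) • ∑ γ ∈ insert δ s, u γ := by
          rw [Finset.mul_sum, Finset.sum_mul, Finset.smul_sum, ← Finset.sum_sub_distrib,
            ← Finset.sum_sub_distrib, Finset.sum_insert hδ, H_commutator i (hu δ), sub_self,
            zero_add]
          refine Finset.sum_congr rfl fun γ _ => ?_
          rw [H_commutator i (hu γ)]
          exact sub_smul (γ i : K) (δ i : K) (u γ)
        rw [h2]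
        exact sub_mem (sub_mem (hM _ hH _ hs).1 (hM _ hH _ hs).2) (M.smul_mem _ hs)
      have h3 := ih (fun γ => ((γ i : K) - δ i) • u γ)
        (fun γ => (homog γ).smul_mem _ (hu γ)) h1 γ hγ
      have h4 : (γ i : K) - δ i ≠ 0 := sub_ne_zero.2 (Int.cast_injective.ne hi)
      exact (M.smul_mem_iff h4).1 h3
    intro γ hγ
    rcases Finset.mem_insert.1 hγ with rfl | hγ
    · rw [Finset.sum_insert hδ] at hs
      exact (M.add_mem_iff_left (M.sum_mem key)).1 hs
    · exact key γ hγ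

/-- Induction on $\sum_i|\gamma_i|$: a negative degree is raised by $\int_i$ and restored by
$\partial_i\int_i=1$; a positive one is lowered by $\partial_i$ and restored by $\int_i$. -/
theorem homog_mem_of_diagonal_le {A : Subalgebra K (EndP K n)} {M M' : Submodule K (EndP K n)}
    (hA : integroDiffAlgebra K n ≤ A) (hMA : ∀ u ∈ M, u ∈ A) (hM : IsBimodule A M)
    (hM' : IsBimodule A M') (hle : ∀ u ∈ M, u ∈ diagonalAlgebra K n → u ∈ M')
    {γ : Fin n → ℤ} {u : EndP K n} (hu : u ∈ homog γ) (huM : u ∈ M) : u ∈ M' := by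
  induction hs : ∑ i, (γ i).natAbs using Nat.strong_induction_on generalizing γ u with
  | _ s ih =>
    have hlt : ∀ δ : Fin n → ℤ, ∀ i, (δ i).natAbs < (γ i).natAbs → (∀ j, j ≠ i → δ j = γ j) →
        ∑ i, (δ i).natAbs < s := by
      intro δ i h1 h2
      rw [← hs]
      refine Finset.sum_lt_sum (fun j _ => ?_) ⟨i, Finset.mem_univ i, h1⟩
      by_cases hj : j = i
      · exact hj ▸ h1.le
      · rw [h2 j hj]
    have hD := fun i => hA (D_mem_integroDiff (K := K) i)
    have hJ := fun i => hA (J_mem_integroDiff (K := K) i)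
    by_cases h : ∃ i, γ i ≠ 0
    · obtain ⟨i, hi⟩ := h
      rcases lt_or_gt_of_ne hi with hi | hi
      · rw [← one_mul u, ← D_mul_J i, mul_assoc]
        refine (hM' _ (hD i) _ (ih _ ?_ (J_mul_mem_homog i hu) (hM _ (hJ i) _ huM).1 rfl)).1
        refine hlt _ i ?_ fun j hj => ?_
        · simp only [Pi.add_apply, Pi.single_eq_same]
          omega
        · simp [hj]
      · rw [← J_mul_D_mul_eq_self hi hu]
        refine (hM' _ (hJ i) _ (ih _ ?_ (D_mul_mem_homog i hu) (hM _ (hD i) _ huM).1 rfl)).1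
        refine hlt _ i ?_ fun j hj => ?_
        · simp only [Pi.sub_apply, Pi.single_eq_same]
          omega
        · simp [hj]
    · push Not at h
      obtain rfl : γ = 0 := funext h
      obtain ⟨f, hf, rfl⟩ := eq_diag_of_mem_homog_zero hu
      exact diag_mem_of_diagonal_le hA hMA hM hM' hle hf huM

/-- A bimodule is determined by its diagonal idempotents. -/
theorem le_of_diagonal_le {A : Subalgebra K (EndP K n)} {M M' : Submodule K (EndP K n)}
    (hA : integroDiffAlgebra K n ≤ A) (hA' : A ≤ jacobianAlgebra K n) (hMA : ∀ u ∈ M, u ∈ A)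
    (hM : IsBimodule A M) (hM' : IsBimodule A M')
    (hle : ∀ u ∈ M, u ∈ diagonalAlgebra K n → u ∈ M') : M ≤ M' := by
  intro u hu
  obtain ⟨v, hv, rfl⟩ := (Submodule.mem_iSup_iff_exists_finsupp _ _).1
    (jacobianAlgebra_le_iSup_homog (hA' (hMA u hu)))
  have hvM := homogeneous_of_isBimodule hA hM v.support v hv hu
  exact sum_mem fun γ hγ => homog_mem_of_diagonal_le hA hMA hM hM' hle (hv γ) (hvM γ hγ)

end Main

/-! ### Idempotent ideals, restriction and extension. -/

section TwoSidedIdeals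

variable {R : Type*} [Ring R]

theorem mem_add_of_left {a b : TwoSided R} {x : R} (h : x ∈ a.1) : x ∈ (a + b).1 :=
  Submodule.mem_sup_left h

theorem mem_add_of_right {a b : TwoSided R} {x : R} (h : x ∈ b.1) : x ∈ (a + b).1 :=
  Submodule.mem_sup_right h

theorem add_le {a b c : TwoSided R} (ha : a.1 ≤ c.1) (hb : b.1 ≤ c.1) : (a + b).1 ≤ c.1 :=
  sup_le ha hb

/-- If all ideals are idempotent then products of ideals are intersections. -/
theorem mul_eq_inf (h : ∀ a : TwoSided R, a.1 ≤ (a * a).1) (a b : TwoSided R) : a * b = a ⊓ b := by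
  refine Subtype.ext (le_antisymm ?_ ?_)
  · refine Ideal.mul_le.2 fun x hx y hy => ⟨?_, b.1.mul_mem_left x hy⟩
    exact a.2.mul_mem_of_left y hx
  · exact (h (a ⊓ b)).trans (Ideal.mul_mono inf_le_left inf_le_right)

end TwoSidedIdeals

section ResExt

variable {K E : Type*} [Field K] [Ring E] [Algebra K E] {B A : Subalgebra K E}

theorem inclusion_mem_ext (h : B ≤ A) {b : TwoSided B} {u : B} (hu : u ∈ b.1) :
    Subalgebra.inclusion h u ∈ (ext h b).1 :=
  Ideal.subset_span ⟨u, hu, 1, (mul_one _).symm⟩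

theorem ext_le (h : B ≤ A) {b : TwoSided B} {a : TwoSided A} (hb : b.1 ≤ (res h a).1) :
    (ext h b).1 ≤ a.1 := by
  refine Ideal.span_le.2 ?_
  rintro _ ⟨u, hu, c, rfl⟩
  exact a.2.mul_mem_of_left c (hb hu)

theorem res_mono (h : B ≤ A) {a b : TwoSided A} (hab : a.1 ≤ b.1) : (res h a).1 ≤ (res h b).1 :=
  Ideal.comap_mono hab

theorem res_res {C : Subalgebra K E} (h : C ≤ B) (h' : B ≤ A) (a : TwoSided A) :
    res h (res h' a) = res (h.trans h') a := rfl

theorem res_le_res_ext_res {C : Subalgebra K E} (h : C ≤ B) (h' : B ≤ A) (a : TwoSided A) :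
    (res (h.trans h') a).1 ≤ (res (h.trans h') (ext h' (res h' a))).1 :=
  fun u hu => inclusion_mem_ext h' (u := Subalgebra.inclusion h u) hu

/-- An order reflecting restriction map, the image of which is closed under sums, respects the
operations if all ideals are idempotent. -/
theorem preservesIdealOps_res (h : B ≤ A)
    (hle : ∀ a b : TwoSided A, (res h a).1 ≤ (res h b).1 → a.1 ≤ b.1)
    (hadd : ∀ a b : TwoSided A, ∃ c, res h c = res h a + res h b)
    (hA : ∀ a : TwoSided A, a.1 ≤ (a * a).1) (hB : ∀ b : TwoSided B, b.1 ≤ (b * b).1) :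
    PreservesIdealOps (res h) where
  map_add a b := by
    -- Order reflection gives `a, b ≤ c`, so the restriction of `a + b` cannot exceed that of `c`.
    obtain ⟨c, hc⟩ := hadd a b
    refine Subtype.ext (le_antisymm ?_ ?_)
    · rw [← hc]
      refine res_mono h (add_le (hle _ _ ?_) (hle _ _ ?_)) <;> rw [hc]
      · exact fun x => mem_add_of_left
      · exact fun x => mem_add_of_right
    · exact add_le (res_mono h fun x => mem_add_of_left) (res_mono h fun x => mem_add_of_right)
  map_mul a b := by
    rw [mul_eq_inf hA, mul_eq_inf hB]
    rfl
  map_inf a b := rfl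

end ResExt

theorem PreservesIdealOps.inverse {R S : Type*} [Ring R] [Ring S] {f : TwoSided R → TwoSided S}
    {g : TwoSided S → TwoSided R} (hf : PreservesIdealOps f) (hgf : Function.LeftInverse g f)
    (hfg : Function.RightInverse g f) : PreservesIdealOps g where
  map_add a b := hgf.injective.eq_iff.1 (by rw [hf.map_add, hfg, hfg, hfg])
  map_mul a b := hgf.injective.eq_iff.1 (by rw [hf.map_mul, hfg, hfg, hfg])
  map_inf a b := hgf.injective.eq_iff.1 (by rw [hf.map_inf, hfg, hfg, hfg])

/-! ### Local units and stable ideals. -/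

section Diagonal

variable {K : Type*} [Field K] [CharZero K] {n : ℕ}

/-- Regularity gives `u = u * (c * u)`, and `c * u` lies in the ideal. These local units yield
idempotence and detect membership in an ideal. -/
theorem exists_mem_mul_eq_self {b : TwoSided (diagonalAlgebra K n)} {u : diagonalAlgebra K n}
    (hu : u ∈ b.1) : ∃ w ∈ b.1, u * w = u := by
  obtain ⟨c, hc, h⟩ := exists_mul_mul_eq_self u.2
  exact ⟨⟨c, hc⟩ * u, b.1.mul_mem_left _ hu, Subtype.ext h⟩

theorem diagonal_le_mul_self (b : TwoSided (diagonalAlgebra K n)) : b.1 ≤ (b * b).1 := by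
  intro u hu
  obtain ⟨w, hw, h⟩ := exists_mem_mul_eq_self hu
  rw [← h]
  exact Ideal.mul_mem_mul hu hw

omit [CharZero K] in
theorem diag_mul_X (i : Fin n) (f : (Fin n →₀ ℕ) → K) :
    diag f * X K i = X K i * diag (shiftUp i f) := by
  refine end_ext fun α => ?_
  rw [Module.End.mul_apply, Module.End.mul_apply, X_monomial, diag_monomial, diag_monomial,
    X_monomial, shiftUp]

omit [CharZero K] in
theorem diag_mul_Hinv (i : Fin n) (f : (Fin n →₀ ℕ) → K) :
    diag f * Hinv K i = Hinv K i * diag f := by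
  refine end_ext fun α => ?_
  rw [Module.End.mul_apply, Module.End.mul_apply, Hinv_monomial, diag_monomial, diag_monomial,
    Hinv_monomial, mul_one, one_mul]

/-- The values of `shiftDown` at `α i = 0` do not matter, as $\partial_i$ kills those monomials. -/
theorem diag_mul_D (i : Fin n) (f : (Fin n →₀ ℕ) → K) :
    diag f * D K i = D K i * diag (shiftDown i f) := by
  refine end_ext fun α => ?_
  rw [Module.End.mul_apply, Module.End.mul_apply, D_monomial, diag_monomial, diag_monomial,
    D_monomial, shiftDown]
  split_ifs with h
  · simp [h]
  · rw [one_mul, mul_one]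

theorem shiftUp_mem_of_stable {b : TwoSided (diagonalAlgebra K n)} (hb : b ∈ stableIdeals K n)
    (i : Fin n) {u : diagonalAlgebra K n} (hu : u ∈ b.1) {f : (Fin n →₀ ℕ) → K}
    (hf : diag f = (u : EndP K n)) :
    ∃ c ∈ b.1, (c : EndP K n) = diag (shiftUp i f) ∧
      ∃ c ∈ b.1, (c : EndP K n) = diag (shiftDown i f) := by
  obtain ⟨c, hc, h⟩ := (hb i).1 u hu
  obtain ⟨c', hc', h'⟩ := (hb i).2 u hu
  rw [← hf] at h h'
  exact ⟨c', hc', h'.trans (tau_diag i f), c, hc, h.trans (sigma_diag i f)⟩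

/-- Elements of a stable ideal can be moved to the right of a given operator. -/
theorem exists_mul_mul_eq_mul {b : TwoSided (diagonalAlgebra K n)} (hb : b ∈ stableIdeals K n)
    {c : EndP K n} (hc : c ∈ jacobianAlgebra K n) (u : diagonalAlgebra K n) (hu : u ∈ b.1) :
    ∃ w ∈ b.1, (u : EndP K n) * c * w = u * c := by
  -- If `u * g = g * v` with `v` in the ideal, a local unit of `v` works.
  have key : ∀ (g : EndP K n) (u v : diagonalAlgebra K n), v ∈ b.1 → (u : EndP K n) * g = g * v →
      ∃ w ∈ b.1, (u : EndP K n) * g * w = u * g := by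
    intro g u v hv h
    obtain ⟨w, hw, hvw⟩ := exists_mem_mul_eq_self hv
    have hvw' : (v : EndP K n) * w = v := congrArg Subtype.val hvw
    exact ⟨w, hw, by rw [h, mul_assoc, hvw']⟩
  induction hc using Algebra.adjoin_induction generalizing u with
  | mem g hg =>
    obtain ⟨f, -, hf⟩ := mem_diagonalAlgebra.1 u.2
    obtain ((⟨i, rfl⟩ | ⟨i, rfl⟩) | ⟨i, rfl⟩) := hg
    · obtain ⟨c, hc, h, -⟩ := shiftUp_mem_of_stable hb i hu hf
      exact key _ u c hc (by rw [h, ← hf, diag_mul_X])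
    · obtain ⟨-, -, -, c, hc, h⟩ := shiftUp_mem_of_stable hb i hu hf
      exact key _ u c hc (by rw [h, ← hf, diag_mul_D])
    · exact key _ u u hu (by rw [← hf, diag_mul_Hinv])
  | algebraMap r => exact key _ u u hu (Algebra.commutes r _).symm
  | add c c' _ _ hc hc' =>
    obtain ⟨w, hw, h⟩ := hc u hu
    obtain ⟨w', hw', h'⟩ := hc' u hu
    -- Since `1 - (w + w' - w * w') = (1 - w) * (1 - w')` with commuting factors, this is a common
    -- local unit for both summands.
    refine ⟨w + w' - w * w', sub_mem (add_mem hw hw') (b.1.mul_mem_left _ hw'), ?_⟩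
    have hcomm : (w : EndP K n) * w' = w' * w := mul_comm_of_mem_diagonalAlgebra w.2 w'.2
    have h1 : (u : EndP K n) * c * (w + w' - w * w') = u * c := by
      rw [mul_sub, mul_add, ← mul_assoc _ (w : EndP K n), h, add_sub_cancel_right]
    have h2 : (u : EndP K n) * c' * (w + w' - w * w') = u * c' := by
      rw [hcomm, mul_sub, mul_add, ← mul_assoc _ (w' : EndP K n), h', add_sub_cancel_left]
    calc (u : EndP K n) * (c + c') * (w + w' - w * w')
        = u * c * (w + w' - w * w') + u * c' * (w + w' - w * w') := by rw [mul_add, add_mul]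
      _ = u * (c + c') := by rw [h1, h2, mul_add]
  | mul c c' _ _ hc hc' =>
    obtain ⟨w, hw, h⟩ := hc u hu
    -- The second hypothesis is applied to `w`, not `u`: `u * c * c' = u * c * (w * c')`, and `w'`
    -- fixes `w * c'`.
    obtain ⟨w', hw', h'⟩ := hc' w hw
    refine ⟨w', hw', ?_⟩
    rw [← mul_assoc, ← h, mul_assoc (_ * _) _ c', mul_assoc (_ * _) _ (w' : EndP K n), h']

end Diagonal

/-! ### Ideals of algebras between $\mathbb I_n$ and $\mathbb A_n$. -/

section Intermediate

variable {K : Type*} [Field K] [CharZero K] {n : ℕ} {A : Subalgebra K (EndP K n)}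

/-- An ideal of a subalgebra as a subspace of the algebra of all operators. -/
def toSubspace (a : TwoSided A) : Submodule K (EndP K n) where
  carrier := {u | ∃ h : u ∈ A, (⟨u, h⟩ : A) ∈ a.1}
  zero_mem' := ⟨zero_mem _, a.1.zero_mem⟩
  add_mem' := fun ⟨h, hu⟩ ⟨h', hu'⟩ => ⟨add_mem h h', a.1.add_mem hu hu'⟩
  smul_mem' := fun r u ⟨h, hu⟩ => ⟨A.smul_mem h r, by
    have := a.1.mul_mem_left (algebraMap K A r) hu
    rwa [← Algebra.smul_def] at this⟩

omit [CharZero K] in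
theorem isBimodule_toSubspace (a : TwoSided A) : IsBimodule A (toSubspace a) :=
  fun x hx _ ⟨h, hu⟩ => ⟨⟨mul_mem hx h, a.1.mul_mem_left ⟨x, hx⟩ hu⟩,
    ⟨mul_mem h hx, a.2.mul_mem_of_left ⟨x, hx⟩ hu⟩⟩

/-- An ideal of an algebra between `I_n` and `A_n` is determined by its diagonal elements. -/
theorem le_of_res_diagonal_le (hI : integroDiffAlgebra K n ≤ A) (hJ : A ≤ jacobianAlgebra K n)
    (hF : diagonalAlgebra K n ≤ A) {a b : TwoSided A} (h : (res hF a).1 ≤ (res hF b).1) :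
    a.1 ≤ b.1 := by
  have : toSubspace a ≤ toSubspace b :=
    le_of_diagonal_le hI hJ (fun _ hu => hu.1) (isBimodule_toSubspace a) (isBimodule_toSubspace b)
      fun u ⟨_, hu⟩ huF => ⟨hF huF, h (x := ⟨u, huF⟩) hu⟩
  exact fun u hu => (this ⟨u.2, hu⟩).2

/-- It suffices to compare diagonal parts, where `u = u * w` with both factors in `a`. -/
theorem le_mul_self (hI : integroDiffAlgebra K n ≤ A) (hJ : A ≤ jacobianAlgebra K n)
    (a : TwoSided A) : a.1 ≤ (a * a).1 := by
  have hF := (diagonal_le_integroDiff K n).trans hI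
  refine le_of_res_diagonal_le hI hJ hF fun u hu => ?_
  obtain ⟨w, hw, h⟩ := exists_mem_mul_eq_self (b := res hF a) hu
  rw [← h]
  change Subalgebra.inclusion hF (u * w) ∈ (a * a).1
  rw [map_mul]
  exact Ideal.mul_mem_mul hu hw

theorem res_mem_stableIdeals (hI : integroDiffAlgebra K n ≤ A) (hF : diagonalAlgebra K n ≤ A)
    (a : TwoSided A) : res hF a ∈ stableIdeals K n := by
  have hD := fun i => hI (D_mem_integroDiff (K := K) i)
  have hJ := fun i => hI (J_mem_integroDiff (K := K) i)
  have hM := isBimodule_toSubspace a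
  refine fun i => ⟨fun u hu => ⟨⟨_, sigma_mem i u.2⟩, ?_, rfl⟩,
    fun u hu => ⟨⟨_, tau_mem i u.2⟩, ?_, rfl⟩⟩
  · exact (hM _ (hD i) _ (hM _ (hJ i) u ⟨hF u.2, hu⟩).1).2.2
  · exact (hM _ (hJ i) _ (hM _ (hD i) u ⟨hF u.2, hu⟩).1).2.2

/-- Each element of the extension has a right local unit in `b`. For a diagonal `z` the equation `z
= z * w` puts `z` itself into `b`. -/
theorem res_ext_of_stable (hJ : A ≤ jacobianAlgebra K n) (hF : diagonalAlgebra K n ≤ A)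
    {b : TwoSided (diagonalAlgebra K n)} (hb : b ∈ stableIdeals K n) : res hF (ext hF b) = b := by
  refine Subtype.ext (le_antisymm (fun z hz => ?_) fun u hu => inclusion_mem_ext hF hu)
  have key : ∀ z ∈ (ext hF b).1, ∃ w ∈ b.1, (z : EndP K n) * w = z := by
    intro z hz
    induction hz using Submodule.span_induction with
    | mem z hz =>
      obtain ⟨u, hu, c, rfl⟩ := hz
      exact exists_mul_mul_eq_mul hb (hJ c.2) u hu
    | zero => exact ⟨0, b.1.zero_mem, mul_zero _⟩
    | add y z _ _ hy hz =>
      obtain ⟨w, hw, h⟩ := hy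
      obtain ⟨w', hw', h'⟩ := hz
      refine ⟨w + w' - w * w', sub_mem (add_mem hw hw') (b.1.mul_mem_left _ hw'), ?_⟩
      have hcomm : (w : EndP K n) * w' = w' * w := mul_comm_of_mem_diagonalAlgebra w.2 w'.2
      have h1 : (y : EndP K n) * (w + w' - w * w') = y := by
        rw [mul_sub, mul_add, ← mul_assoc _ (w : EndP K n), h, add_sub_cancel_right]
      have h2 : (z : EndP K n) * (w + w' - w * w') = z := by
        rw [hcomm, mul_sub, mul_add, ← mul_assoc _ (w' : EndP K n), h', add_sub_cancel_left]
      exact (add_mul (y : EndP K n) z _).trans (congrArg₂ _ h1 h2)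
    | smul a y _ hy =>
      obtain ⟨w, hw, h⟩ := hy
      exact ⟨w, hw, (mul_assoc (a : EndP K n) y w).trans (congrArg _ h)⟩
  obtain ⟨w, hw, h⟩ := key _ hz
  have h' : z * w = z := Subtype.ext h
  rw [← h']
  exact b.1.mul_mem_left _ hw

omit [CharZero K] in
theorem add_mem_stableIdeals {a b : TwoSided (diagonalAlgebra K n)} (ha : a ∈ stableIdeals K n)
    (hb : b ∈ stableIdeals K n) : a + b ∈ stableIdeals K n := by
  refine fun i => ⟨fun x hx => ?_, fun x hx => ?_⟩ <;>
    obtain ⟨u, hu, v, hv, rfl⟩ := Submodule.mem_sup.1 hx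
  · obtain ⟨c, hc, h⟩ := (ha i).1 u hu
    obtain ⟨d, hd, h'⟩ := (hb i).1 v hv
    refine ⟨c + d, Submodule.add_mem_sup hc hd, ?_⟩
    simp only [Subalgebra.coe_add, h, h', sigma, mul_add, add_mul]
  · obtain ⟨c, hc, h⟩ := (ha i).2 u hu
    obtain ⟨d, hd, h'⟩ := (hb i).2 v hv
    refine ⟨c + d, Submodule.add_mem_sup hc hd, ?_⟩
    simp only [Subalgebra.coe_add, h, h', tau, mul_add, add_mul]

/-- For every algebra between `I_n` and `A_n`, restriction to the diagonal algebra is a bijection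
onto the stable ideals, with inverse the extension map, that respects the operations. -/
theorem res_diagonal (hI : integroDiffAlgebra K n ≤ A) (hJ : A ≤ jacobianAlgebra K n)
    (hF : diagonalAlgebra K n ≤ A) :
    Set.BijOn (res hF) Set.univ (stableIdeals K n) ∧
      Set.InvOn (ext hF) (res hF) Set.univ (stableIdeals K n) ∧ PreservesIdealOps (res hF) := by
  have hmaps := res_mem_stableIdeals hI hF
  have hinv : Set.InvOn (ext hF) (res hF) Set.univ (stableIdeals K n) := by
    refine ⟨fun a _ => Subtype.ext (le_antisymm ?_ ?_), fun b hb => res_ext_of_stable hJ hF hb⟩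
    · exact ext_le hF le_rfl
    · refine le_of_res_diagonal_le hI hJ hF ?_
      rw [res_ext_of_stable hJ hF (hmaps a)]
  refine ⟨hinv.bijOn (fun a _ => hmaps a) fun _ _ => Set.mem_univ _, hinv, ?_⟩
  exact preservesIdealOps_res hF (fun a b => le_of_res_diagonal_le hI hJ hF)
    (fun a b => ⟨_, res_ext_of_stable hJ hF (add_mem_stableIdeals (hmaps a) (hmaps b))⟩)
    (le_mul_self hI hJ) diagonal_le_mul_self

variable (K n)

theorem leftInverse_ext_res :
    Function.LeftInverse (ext (integroDiff_le_jacobian K n))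
      (res (integroDiff_le_jacobian K n)) := by
  refine fun a => Subtype.ext (le_antisymm (ext_le _ le_rfl) ?_)
  exact le_of_res_diagonal_le (integroDiff_le_jacobian K n) le_rfl (diagonal_le_jacobian K n)
    (res_le_res_ext_res (diagonal_le_integroDiff K n) (integroDiff_le_jacobian K n) a)

/-- Extending the diagonal part of `b` to $\mathbb A_n$ and restricting to $\mathbb I_n$ gives an
ideal with the same diagonal part as `b`, hence `b`. -/
theorem surjective_res : Function.Surjective (res (integroDiff_le_jacobian K n)) := by
  intro b
  have hinj := (res_diagonal le_rfl (integroDiff_le_jacobian K n)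
    (diagonal_le_integroDiff K n)).1.injOn
  have hb := res_mem_stableIdeals le_rfl (diagonal_le_integroDiff K n) b
  refine ⟨ext (diagonal_le_jacobian K n) (res (diagonal_le_integroDiff K n) b),
    hinj (Set.mem_univ _) (Set.mem_univ _) ?_⟩
  rw [res_res, res_ext_of_stable le_rfl (diagonal_le_jacobian K n) hb]

theorem bijective_res : Function.Bijective (res (integroDiff_le_jacobian K n)) :=
  ⟨(leftInverse_ext_res K n).injective, surjective_res K n⟩

theorem rightInverse_ext_res :
    Function.RightInverse (ext (integroDiff_le_jacobian K n))
      (res (integroDiff_le_jacobian K n)) :=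
  (leftInverse_ext_res K n).rightInverse_of_surjective (surjective_res K n)

theorem preservesIdealOps_res_integroDiff :
    PreservesIdealOps (res (integroDiff_le_jacobian K n)) := by
  refine preservesIdealOps_res _ (fun a b h => ?_) (fun a b => surjective_res K n _)
    (le_mul_self (integroDiff_le_jacobian K n) le_rfl)
    (le_mul_self le_rfl (integroDiff_le_jacobian K n))
  rw [← leftInverse_ext_res K n a]
  exact ext_le _ h

end Intermediate

end IntegroDiff

end

theorem mainTheorem1 (K : Type*) [Field K] [CharZero K] (n : ℕ) :
    (Function.Bijective (IntegroDiff.res (IntegroDiff.integroDiff_le_jacobian K n)) ∧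
      Function.LeftInverse (IntegroDiff.ext (IntegroDiff.integroDiff_le_jacobian K n))
        (IntegroDiff.res (IntegroDiff.integroDiff_le_jacobian K n)) ∧
      Function.RightInverse (IntegroDiff.ext (IntegroDiff.integroDiff_le_jacobian K n))
        (IntegroDiff.res (IntegroDiff.integroDiff_le_jacobian K n)) ∧
      IntegroDiff.PreservesIdealOps (IntegroDiff.res (IntegroDiff.integroDiff_le_jacobian K n))) ∧
    IntegroDiff.IdealEquivalent (IntegroDiff.integroDiffAlgebra K n)
      (IntegroDiff.jacobianAlgebra K n) ∧
    (∀ a b : IntegroDiff.diagonalAlgebra K n, a * b = b * a) ∧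
    (Set.BijOn (IntegroDiff.res (IntegroDiff.diagonal_le_integroDiff K n)) Set.univ
        (IntegroDiff.stableIdeals K n) ∧
      Set.InvOn (IntegroDiff.ext (IntegroDiff.diagonal_le_integroDiff K n))
        (IntegroDiff.res (IntegroDiff.diagonal_le_integroDiff K n)) Set.univ
        (IntegroDiff.stableIdeals K n) ∧
      IntegroDiff.PreservesIdealOps (IntegroDiff.res (IntegroDiff.diagonal_le_integroDiff K n))) ∧
    (Set.BijOn (IntegroDiff.res (IntegroDiff.diagonal_le_jacobian K n)) Set.univ
        (IntegroDiff.stableIdeals K n) ∧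
      Set.InvOn (IntegroDiff.ext (IntegroDiff.diagonal_le_jacobian K n))
        (IntegroDiff.res (IntegroDiff.diagonal_le_jacobian K n)) Set.univ
        (IntegroDiff.stableIdeals K n) ∧
      IntegroDiff.PreservesIdealOps (IntegroDiff.res (IntegroDiff.diagonal_le_jacobian K n))) :=

  ⟨⟨IntegroDiff.bijective_res K n, IntegroDiff.leftInverse_ext_res K n,
      IntegroDiff.rightInverse_ext_res K n, IntegroDiff.preservesIdealOps_res_integroDiff K n⟩,
    ⟨_, ⟨(IntegroDiff.rightInverse_ext_res K n).injective,
        (IntegroDiff.leftInverse_ext_res K n).surjective⟩,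
      (IntegroDiff.preservesIdealOps_res_integroDiff K n).inverse
        (IntegroDiff.leftInverse_ext_res K n) (IntegroDiff.rightInverse_ext_res K n)⟩,
    fun a b => Subtype.ext (IntegroDiff.mul_comm_of_mem_diagonalAlgebra a.2 b.2),
    IntegroDiff.res_diagonal le_rfl (IntegroDiff.integroDiff_le_jacobian K n)
      (IntegroDiff.diagonal_le_integroDiff K n),
    IntegroDiff.res_diagonal (IntegroDiff.integroDiff_le_jacobian K n) le_rfl
      (IntegroDiff.diagonal_le_jacobian K n)⟩
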